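/- Let $L$ be a finite-dimensional Lie algebra over a field $\mathbb F$ of characteristic zero. A chief series of $L$ is a chain of ideals $0=L_0\subset L_1\subset\cdots\subset L_n=L$ such that $L_j/L_{j-1}$ is a minimal non-zero ideal of $L/L_{j-1}$ for every $1\le j\le n$. For a finite-dimensional irreducible $L$-module $S$ and a given chief series of $L$, let $[L:S]_{\mathrm{split}}$ denote the number of indices $j\in\{1,\dots,n\}$ such that $L_j/L_{j-1}$ is an abelian Lie algebra, $L_j/L_{j-1}$ is isomorphic to $S$ as an $L$-module, and the exact sequence $0\to L_j/L_{j-1}\to L/L_{j-1}\to L/L_j\to 0$ splits in the category of Lie algebras (that is, the projection $L/L_{j-1}\to L/L_j$ has a section which is a homomorphism of Lie algebras). Then, for every finite-dimensional irreducible $L$-module $S$ and every chief series of $L$, $$\dim_{\mathbb F} H^1(L,S)=\dim_{\mathbb F}\operatorname{End}_L(S)\cdot[L:S]_{\mathrm{split}},$$ where $H^1(L,S)$ is the first (Chevalley–Eilenberg) cohomology space of $L$ with coefficients in $S$. -/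

import Mathlib

noncomputable section

namespace LieChief

section Cohomology

variable (F L M : Type*) [Field F] [LieRing L] [LieAlgebra F L]
  [AddCommGroup M] [Module F M] [LieRingModule L M] [LieModule F L M]

/-- The Chevalley-Eilenberg differential `M → Hom_F(L, M)` from degree 0 to degree 1: it sends `m`
to the map `x ↦ ⁅x, m⁆`. -/
def d₀₁ : M →ₗ[F] LieModule.Cohomology.oneCochain F L M :=
  (LieModule.toEnd F L M : L →ₗ[F] Module.End F M).flip

@[simp]
theorem d₀₁_apply (m : M) (x : L) : d₀₁ F L M m x = ⁅x, m⁆ := rfl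

/-- The space `Z¹(L, M)` of 1-cocycles, the kernel of the differential from degree 1 to degree 2
(`f ↦ ((x, y) ↦ ⁅x, f y⁆ - ⁅y, f x⁆ - f ⁅x, y⁆)`). -/
def oneCocycles : Submodule F (LieModule.Cohomology.oneCochain F L M) :=
  LinearMap.ker (LieModule.Cohomology.d₁₂ F L M)

/-- The space `B¹(L, M)` of 1-coboundaries. -/
def oneCoboundaries : Submodule F (LieModule.Cohomology.oneCochain F L M) :=
  LinearMap.range (d₀₁ F L M)

theorem oneCoboundaries_le_oneCocycles : oneCoboundaries F L M ≤ oneCocycles F L M := by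
  rintro _ ⟨m, rfl⟩
  refine LinearMap.mem_ker.2 (Subtype.ext (LinearMap.ext fun x => LinearMap.ext fun y => ?_))
  simp

/-- The first cohomology space `H¹(L, M) = Z¹(L, M) / B¹(L, M)`. -/
abbrev H1 : Type _ :=
  oneCocycles F L M ⧸ (oneCoboundaries F L M).submoduleOf (oneCocycles F L M)

end Cohomology

section Quotients

variable {F L : Type*} [Field F] [LieRing L] [LieAlgebra F L]

/-- The canonical projection `L → L/I` as a homomorphism of Lie algebras. -/
def quotHom (I : LieIdeal F L) : L →ₗ⁅F⁆ L ⧸ I where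
  toLinearMap := I.toSubmodule.mkQ
  map_lie' := rfl

/-- The canonical projection `L/I → L/J` for ideals `I ≤ J`, as a homomorphism of Lie algebras. -/
def quotFactor {I J : LieIdeal F L} (h : I ≤ J) : (L ⧸ I) →ₗ⁅F⁆ (L ⧸ J) where
  toLinearMap := Submodule.factor (p := I.toSubmodule) (p' := J.toSubmodule) h
  map_lie' {x y} := by
    obtain ⟨x, rfl⟩ := I.toSubmodule.mkQ_surjective x
    obtain ⟨y, rfl⟩ := I.toSubmodule.mkQ_surjective y
    rfl

/-- `J/I` as an ideal of the Lie algebra `L/I`: the image of `J` in `L/I`. -/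
def quotIdeal (I J : LieIdeal F L) : LieIdeal F (L ⧸ I) :=
  J.map (quotHom I)

/-- `J/I` and `S` are isomorphic as `L`-modules. Here `x : L` acts on `J/I` by the bracket with
the class of `x` in `L/I`. -/
def IsModuleIso (I J : LieIdeal F L) (S : Type*) [AddCommGroup S] [Module F S]
    [LieRingModule L S] : Prop :=
  ∃ e : quotIdeal I J ≃ₗ[F] S, ∀ (x : L) (v : quotIdeal I J), e ⁅quotHom I x, v⁆ = ⁅x, e v⁆

/-- The extension `0 → J/I → L/I → L/J → 0` splits in the category of Lie algebras, i.e.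
the projection `L/I → L/J` has a section that is a Lie algebra homomorphism. -/
def IsSplit {I J : LieIdeal F L} (h : I ≤ J) : Prop :=
  ∃ s : (L ⧸ J) →ₗ⁅F⁆ (L ⧸ I), (quotFactor h).comp s = LieHom.id

end Quotients

/-- A chief series of `L`: a chain `0 = L₀ ⊂ L₁ ⊂ ⋯ ⊂ Lₙ = L` of ideals such that every factor
`Lⱼ₊₁/Lⱼ` is a minimal non-zero ideal of `L/Lⱼ`. -/
structure ChiefSeries (F L : Type*) [Field F] [LieRing L] [LieAlgebra F L] where
  length : ℕ
  ideal : Fin (length + 1) → LieIdeal F L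
  ideal_zero : ideal 0 = ⊥
  ideal_last : ideal (Fin.last length) = ⊤
  le_succ : ∀ j : Fin length, ideal j.castSucc ≤ ideal j.succ
  minimal : ∀ j : Fin length, IsAtom (quotIdeal (ideal j.castSucc) (ideal j.succ))

/-- `[L : S]_split` computed in the chief series `C`: the number of factors of `C` that are abelian
Lie algebras, are isomorphic to `S` as `L`-modules, and are split. -/
def ChiefSeries.splitMultiplicity {F L : Type*} [Field F] [LieRing L] [LieAlgebra F L]
    (C : ChiefSeries F L) (S : Type*) [AddCommGroup S] [Module F S] [LieRingModule L S] : ℕ :=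
  Set.ncard {j : Fin C.length |
    IsLieAbelian (quotIdeal (C.ideal j.castSucc) (C.ideal j.succ)) ∧
    IsModuleIso (C.ideal j.castSucc) (C.ideal j.succ) S ∧
    IsSplit (C.le_succ j)}

end LieChief

end

/-! ### Linear algebra -/

section LinearAlgebra

variable {F V W : Type*} [Field F] [AddCommGroup V] [Module F V] [AddCommGroup W] [Module F W]

/-! For an ideal `I` let `Z_I` be the space of cocycles vanishing on `I`, and `E_I = Z_I + B¹`
(`cocyclesSplittingOn`). Since `E_0 = Z¹` and `E_L = B¹`, `dim H¹` is the sum of the drops `dim E_I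
- dim E_J` over the chief factors `J/I`, and each factor can be treated alone
(`finrank_cocyclesSplittingOn`).

If `J` acts trivially on `S`, coboundaries vanish on `J`, so the drop is the dimension of the space
of restrictions to `J` of cocycles in `Z_I`. These are `L`-homomorphisms `J/I → S`. A nonzero one is
an isomorphism, and the zeros of its cocycle form a subalgebra complementing `J` modulo `I`, so the
factor splits (`isSplitFactor_of_apply_ne_zero`). Conversely, a splitting gives a cocycle
restricting to an isomorphism (`IsSplitFactor.exists_cocycle`), and composing it with `End_L(S)`
yields every restriction.

If `J` acts nontrivially, the factor is not counted, and `Z_I ⊆ B¹` makes the drop zero. When `I`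
acts nontrivially, `Z_I = 0`. Otherwise the radical of the trace form of `S` on `J` is `I` or `J`.
If it is `I`, a Casimir operator shows that the cocycle is a coboundary. If it is `J`, Cartan's
criterion makes `J` act by commuting operators. Then either `J/I` is central and Schur's lemma
applies to an element of `J`, or `J = I + [L, J]` acts nilpotently, contrary to Engel's theorem. -/

theorem LinearMap.exists_comp_eq_of_ker_le {U : Type*} [AddCommGroup U] [Module F U]
    (g : U →ₗ[F] V) (f : U →ₗ[F] W) (hg : Function.Surjective g)
    (h : ∀ u, g u = 0 → f u = 0) : ∃ k : V →ₗ[F] W, ∀ u, k (g u) = f u := by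
  obtain ⟨r, hr⟩ := g.exists_rightInverse_of_surjective (LinearMap.range_eq_top.2 hg)
  refine ⟨f ∘ₗ r, fun u => ?_⟩
  have h1 : g (r (g u) - u) = 0 := by
    have := LinearMap.congr_fun hr (g u)
    simp only [LinearMap.comp_apply, LinearMap.id_apply] at this
    rw [map_sub, this, sub_self]
  have h2 := h _ h1
  rw [map_sub, sub_eq_zero] at h2
  exact h2

/-- If `T` is skew-adjoint for a nondegenerate symmetric form, then `∑ bᵢ ⊗ bⁱ` is killed by
`T ⊗ 1 + 1 ⊗ T`, where `bⁱ` is the basis dual to `bᵢ`. -/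
theorem LinearMap.BilinForm.sum_dualBasis_of_skew {ι : Type*} [Fintype ι] [DecidableEq ι]
    [FiniteDimensional F V]
    {B : LinearMap.BilinForm F V} (hB : B.Nondegenerate) (hs : B.IsSymm) (b : Module.Basis ι F V)
    (T : V →ₗ[F] V) (hT : ∀ u v, B (T u) v = - B u (T v)) (φ : V →ₗ[F] V →ₗ[F] W) :
    ∑ i, φ (T (b i)) (B.dualBasis hB b i) + ∑ i, φ (b i) (T (B.dualBasis hB b i)) = 0 := by
  set c := B.dualBasis hB b with hc
  have h1 : ∀ i, T (c i) = ∑ j, B (T (c i)) (b j) • c j := fun i => by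
    conv_lhs => rw [← c.sum_repr (T (c i))]
    simp [hc, LinearMap.BilinForm.dualBasis_repr_apply]
  have h2 : ∀ i, T (b i) = ∑ j, B (T (b i)) (c j) • b j := fun i => by
    conv_lhs => rw [← b.sum_repr (T (b i))]
    refine Finset.sum_congr rfl fun j _ => ?_
    have := LinearMap.BilinForm.dualBasis_repr_apply (B := B) hB c (T (b i)) j
    rw [hc, LinearMap.BilinForm.dualBasis_dualBasis hB hs b] at this
    rw [this]
  have h3 : ∑ i, φ (T (b i)) (c i) = ∑ i, ∑ j, B (T (b i)) (c j) • φ (b j) (c i) :=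
    Finset.sum_congr rfl fun i _ => by
      conv_lhs => rw [h2 i]
      simp only [map_sum, LinearMap.sum_apply, map_smul, LinearMap.smul_apply]
  have h4 : ∑ i, φ (b i) (T (c i)) = ∑ i, ∑ j, B (T (c i)) (b j) • φ (b i) (c j) :=
    Finset.sum_congr rfl fun i _ => by
      conv_lhs => rw [h1 i]
      simp only [map_sum, map_smul]
  rw [h3, h4, Finset.sum_comm, ← Finset.sum_add_distrib]
  refine Finset.sum_eq_zero fun i _ => ?_
  rw [← Finset.sum_add_distrib]
  refine Finset.sum_eq_zero fun j _ => ?_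
  rw [← add_smul, hT, hs.eq (b j), neg_add_cancel, zero_smul]

open Polynomial in
/-- In characteristic zero, an endomorphism all of whose positive powers have trace zero is
nilpotent. -/
theorem Module.End.isNilpotent_of_trace_pow_eq_zero [CharZero F] [FiniteDimensional F V]
    (a : Module.End F V) (h : ∀ k, LinearMap.trace F V (a ^ (k + 1)) = 0) : IsNilpotent a := by
  have htr : ∀ p : F[X], LinearMap.trace F V (aeval a (p * X)) = 0 := fun p => by
    induction p using Polynomial.induction_on' with
    | add p q hp hq => rw [add_mul, map_add, map_add, hp, hq, add_zero]
    | monomial n c =>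
      rw [monomial_mul_X, aeval_monomial, ← Algebra.smul_def, map_smul, h, smul_zero]
  have hne : minpoly F a ≠ 0 := minpoly.ne_zero (Algebra.IsIntegral.isIntegral a)
  obtain ⟨q, hq, hq0⟩ := exists_eq_pow_rootMultiplicity_mul_and_not_dvd (minpoly F a) hne 0
  set m := (minpoly F a).rootMultiplicity 0
  rw [C_0, sub_zero] at hq hq0
  have hcop : IsCoprime (X ^ (m + 1)) q :=
    IsCoprime.pow_left ((irreducible_X.coprime_iff_not_dvd).2 hq0)
  obtain ⟨u, v, huv⟩ := hcop
  have hmin : aeval a (X ^ m * q) = 0 := by rw [← hq]; exact minpoly.aeval F a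
  -- The Fitting projection onto the part where `a` is invertible. The exponent `m + 1` makes it a
  -- multiple of `X` even when `m = 0`, so its trace vanishes.
  set e := aeval a (u * X ^ (m + 1)) with he
  have hev : e + aeval a (v * q) = 1 := by
    rw [he, ← map_add, huv, map_one]
  have hee : e * aeval a (v * q) = 0 := by
    rw [he, ← map_mul, show u * X ^ (m + 1) * (v * q) = u * X * v * (X ^ m * q) by ring, map_mul,
      hmin, mul_zero]
  have hid : IsIdempotentElem e := by
    have := congrArg (e * ·) hev
    simp only [mul_add, hee, add_zero, mul_one] at this
    exact this
  have he0 : e = 0 := by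
    refine LinearMap.IsIdempotentElem.eq_zero_of_trace_eq_zero hid ?_
    rw [he, pow_succ, ← mul_assoc]
    exact htr _
  refine ⟨m, ?_⟩
  rw [he0, zero_add] at hev
  calc a ^ m = a ^ m * aeval a (v * q) := by rw [hev, mul_one]
    _ = aeval a (v * (X ^ m * q)) := by
      rw [show v * (X ^ m * q) = X ^ m * (v * q) by ring, map_mul (aeval a) (X ^ m), map_pow,
        aeval_X]
    _ = 0 := by rw [map_mul, hmin, mul_zero]

end LinearAlgebra

noncomputable section
/-! ### Lie modules -/

namespace LieChief

section LieModules

open LieModule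

variable {F L S : Type*} [Field F] [LieRing L] [LieAlgebra F L]
  [AddCommGroup S] [Module F S] [LieRingModule L S] [LieModule F L S]

theorem mem_oneCocycles_iff {f : L →ₗ[F] S} :
    f ∈ oneCocycles F L S ↔ ∀ x y, f ⁅x, y⁆ = ⁅x, f y⁆ - ⁅y, f x⁆ := by
  constructor
  · intro h x y
    have := congrArg (fun c : Cohomology.twoCochain F L S => c x y) (LinearMap.mem_ker.1 h)
    simp only [Cohomology.d₁₂_apply_apply] at this
    exact (sub_eq_zero.1 this).symm
  · intro h
    refine LinearMap.mem_ker.2 (Subtype.ext (LinearMap.ext fun x => LinearMap.ext fun y => ?_))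
    simp [h x y]

theorem mem_oneCoboundaries_iff {f : L →ₗ[F] S} :
    f ∈ oneCoboundaries F L S ↔ ∃ s : S, ∀ x, ⁅x, s⁆ = f x :=
  ⟨fun ⟨s, hs⟩ => ⟨s, fun x => by rw [← hs]; rfl⟩,
    fun ⟨s, hs⟩ => ⟨s, LinearMap.ext fun x => hs x⟩⟩

/-- The ideal `J` annihilates the module `S`. -/
def ActsTrivially (J : LieIdeal F L) (S : Type*) [AddCommGroup S] [LieRingModule L S] : Prop :=
  ∀ y ∈ J, ∀ s : S, ⁅y, s⁆ = 0

/-- The vectors killed by an ideal form a submodule, which irreducibility makes everything. -/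
theorem ActsTrivially.of_invariant [IsIrreducible F L S] {J : LieIdeal F L} {s : S} (hs : s ≠ 0)
    (h : ∀ y ∈ J, ⁅y, s⁆ = 0) : ActsTrivially J S := by
  let N : LieSubmodule F L S :=
    { carrier := {m | ∀ y ∈ J, ⁅y, m⁆ = 0}
      add_mem' := fun {a b} ha hb y hy => by rw [lie_add, ha y hy, hb y hy, add_zero]
      zero_mem' := fun y _ => lie_zero y
      smul_mem' := fun c m hm y hy => by rw [lie_smul, hm y hy, smul_zero]
      lie_mem := fun {x m} hm y hy => by
        rw [leibniz_lie, hm y hy, lie_zero, add_zero]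
        exact hm _ (by simpa using lie_mem_left F L J y x hy) }
  have hN : N = ⊤ := (IsSimpleOrder.eq_bot_or_eq_top N).resolve_left fun hb =>
    hs ((LieSubmodule.mem_bot s).1 (hb ▸ (show s ∈ N from h)))
  exact fun y hy m => (show m ∈ N from hN ▸ LieSubmodule.mem_top m) y hy

/-- Engel's theorem for an ideal acting on an irreducible module. -/
theorem ActsTrivially.of_isNilpotent [FiniteDimensional F S] [IsIrreducible F L S]
    {J : LieIdeal F L} (h : ∀ y ∈ J, IsNilpotent (toEnd F L S y)) : ActsTrivially J S := by
  have : LieModule.IsNilpotent J S :=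
    (LieModule.isNilpotent_iff_forall' (R := F)).2 fun y => h y.1 y.2
  have : Nontrivial S := nontrivial_of_isIrreducible F L S
  have := nontrivial_max_triv_of_isNilpotent F J S
  obtain ⟨⟨s, hs⟩, hs0⟩ := exists_ne (0 : maxTrivSubmodule F J S)
  exact .of_invariant (s := s) (fun h0 => hs0 (Subtype.ext h0)) fun y hy =>
    (mem_maxTrivSubmodule F J S s).1 hs ⟨y, hy⟩

omit [LieAlgebra F L] [LieModule F L S] in
/-- Schur's lemma. -/
theorem bijective_of_commute [FiniteDimensional F S] [IsIrreducible F L S] (a : S →ₗ[F] S)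
    (h : ∀ (x : L) s, a ⁅x, s⁆ = ⁅x, a s⁆) (ha : a ≠ 0) : Function.Bijective a := by
  let N : LieSubmodule F L S :=
    { LinearMap.ker a with
      lie_mem := fun {x m} (hm : a m = 0) => by
        change a ⁅x, m⁆ = 0
        rw [h, hm, lie_zero] }
  have hN : N = ⊥ := (IsSimpleOrder.eq_bot_or_eq_top N).resolve_right fun ht =>
    ha (LinearMap.ext fun s => (show s ∈ N from ht ▸ LieSubmodule.mem_top s))
  have hinj : Function.Injective a := (injective_iff_map_eq_zero a).2 fun s hs =>
    (LieSubmodule.mem_bot s).1 (hN ▸ (show s ∈ N from hs))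
  exact ⟨hinj, LinearMap.injective_iff_surjective.1 hinj⟩

/-- The trace form of `S` on the endomorphisms of `S`, restricted to a subspace. -/
def traceFormOn (V : Submodule F (Module.End F S)) : LinearMap.BilinForm F V :=
  ((LinearMap.mul F (Module.End F S)).compr₂ (LinearMap.trace F S)).compl₁₂ V.subtype V.subtype

theorem traceFormOn_apply (V : Submodule F (Module.End F S)) (u v : V) :
    traceFormOn V u v = LinearMap.trace F S (u.1 * v.1) := rfl

theorem toEnd_lie (x y : L) : toEnd F L S ⁅x, y⁆ =
    toEnd F L S x * toEnd F L S y - toEnd F L S y * toEnd F L S x := by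
  ext s; simp

/-- The Casimir argument: a cocycle is a coboundary if it vanishes on the kernel of an ideal on
which the trace form of the irreducible module is nondegenerate and nonzero. -/
theorem mem_oneCoboundaries_of_nondegenerate [CharZero F] [FiniteDimensional F S]
    [IsIrreducible F L S] {J : LieIdeal F L} (hJ : ¬ ActsTrivially J S)
    (hnd : ∀ y ∈ J, (∀ z ∈ J, LinearMap.trace F S (toEnd F L S y * toEnd F L S z) = 0) →
      ∀ s : S, ⁅y, s⁆ = 0)
    {f : L →ₗ[F] S} (hf : f ∈ oneCocycles F L S)
    (hfJ : ∀ y ∈ J, (∀ s : S, ⁅y, s⁆ = 0) → f y = 0) : f ∈ oneCoboundaries F L S := by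
  classical
  rw [mem_oneCocycles_iff] at hf
  set V : Submodule F (Module.End F S) :=
    J.toSubmodule.map (toEnd F L S : L →ₗ[F] Module.End F S) with hV
  have hmem : ∀ y ∈ J, toEnd F L S y ∈ V := fun y hy => ⟨y, hy, rfl⟩
  let ρ : J.toSubmodule →ₗ[F] V :=
    (toEnd F L S : L →ₗ[F] Module.End F S).restrict (fun y hy => hmem y hy)
  have hρ : ∀ y : J.toSubmodule, (ρ y).1 = toEnd F L S y.1 := fun _ => rfl
  have hρs : Function.Surjective ρ := by
    rintro ⟨_, y, hy, rfl⟩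
    exact ⟨⟨y, hy⟩, rfl⟩
  obtain ⟨g, hg⟩ := LinearMap.exists_comp_eq_of_ker_le ρ (f ∘ₗ J.toSubmodule.subtype) hρs
    fun y hy => hfJ y.1 y.2 fun s => LinearMap.congr_fun (congrArg Subtype.val hy) s
  set B := traceFormOn V with hBdef
  have hsymm : B.IsSymm := ⟨fun u v => LinearMap.trace_mul_comm F _ _⟩
  have hB : B.Nondegenerate := by
    have key : ∀ u, (∀ v, B u v = 0) → u = 0 := fun u hu => by
      obtain ⟨y, rfl⟩ := hρs u
      refine Subtype.ext (LinearMap.ext fun s => ?_)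
      exact hnd y.1 y.2 (fun z hz => hu (ρ ⟨z, hz⟩)) s
    exact ⟨key, fun u hu => key u fun v => by rw [hsymm.eq]; exact hu v⟩
  let T : L → V →ₗ[F] V := fun x =>
    (LinearMap.mulLeft F (toEnd F L S x) - LinearMap.mulRight F (toEnd F L S x)).restrict
      (p := V) (q := V) (by
        rintro _ ⟨y, hy, rfl⟩
        exact ⟨⁅x, y⁆, J.lie_mem hy, toEnd_lie x y⟩)
  have hT : ∀ x v, (T x v).1 = toEnd F L S x * v.1 - v.1 * toEnd F L S x := fun _ _ => rfl
  have hTρ : ∀ x (y : J.toSubmodule), T x (ρ y) = ρ ⟨⁅x, y.1⁆, J.lie_mem y.2⟩ := fun x y =>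
    Subtype.ext (toEnd_lie x y.1).symm
  have hskew : ∀ x u v, B (T x u) v = - B u (T x v) := fun x u v => by
    rw [hBdef, traceFormOn_apply, traceFormOn_apply, hT, hT, sub_mul, mul_sub, map_sub, map_sub,
      mul_assoc, mul_assoc, LinearMap.trace_mul_comm F (toEnd F L S x), mul_assoc]
    abel
  set b := Module.finBasis F V
  set c := B.dualBasis hB b
  -- The Casimir operator of the trace form. It commutes with `L`, and its trace is `dim V`, nonzero
  -- in characteristic zero; by Schur's lemma it is invertible.
  set Ω : Module.End F S := ∑ i, (b i).1 * (c i).1 with hΩ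
  have hΩc : ∀ x (s : S), Ω ⁅x, s⁆ = ⁅x, Ω s⁆ := fun x s => by
    have h := LinearMap.BilinForm.sum_dualBasis_of_skew hB hsymm b (T x) (hskew x)
      ((LinearMap.mul F (Module.End F S)).compl₁₂ V.subtype V.subtype)
    rw [← Finset.sum_add_distrib] at h
    have h' : toEnd F L S x * Ω - Ω * toEnd F L S x = 0 := by
      rw [← h, hΩ, Finset.mul_sum, Finset.sum_mul, ← Finset.sum_sub_distrib]
      refine Finset.sum_congr rfl fun i _ => ?_
      simp only [LinearMap.compl₁₂_apply, Submodule.subtype_apply, LinearMap.mul_apply', hT]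
      noncomm_ring
    exact (LinearMap.congr_fun (sub_eq_zero.1 h') s).symm
  have hΩ0 : Ω ≠ 0 := by
    intro h0
    have htr : LinearMap.trace F S Ω = (Module.finrank F V : F) := by
      have : ∀ i, LinearMap.trace F S ((b i).1 * (c i).1) = 1 := fun i =>
        (LinearMap.BilinForm.apply_dualBasis_right hB hsymm b i i).trans (if_pos rfl)
      rw [hΩ, map_sum, Finset.sum_congr rfl fun i _ => this i]
      simp
    rw [h0, map_zero, eq_comm, Nat.cast_eq_zero, Module.finrank_zero_iff] at htr
    exact hJ fun y hy s => LinearMap.congr_fun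
      (congrArg Subtype.val (Subsingleton.elim (ρ ⟨y, hy⟩) 0)) s
  obtain ⟨hinj, hsurj⟩ := bijective_of_commute Ω hΩc hΩ0
  obtain ⟨s, hs⟩ := hsurj (∑ i, (b i).1 (g (c i)))
  refine mem_oneCoboundaries_iff.2 ⟨s, fun x => hinj ?_⟩
  rw [hΩc, hs]
  -- The cocycle identity, transported from `J` to its image `V`. Summed against the dual bases it
  -- gives `⁅x, ∑ bᵢ g(cᵢ)⁆ = Ω (f x)`.
  have hcomm : ∀ v : V, ⁅x, g v⁆ = g (T x v) + v.1 (f x) := fun v => by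
    obtain ⟨y, rfl⟩ := hρs v
    rw [hTρ, hg, hg, hρ]
    simp only [LinearMap.comp_apply, Submodule.subtype_apply, hf, toEnd_apply_apply]
    abel
  have h := LinearMap.BilinForm.sum_dualBasis_of_skew hB hsymm b (T x) (hskew x)
    ((LinearMap.id (R := F) (M := Module.End F S)).compl₁₂ V.subtype g)
  rw [← Finset.sum_add_distrib] at h
  have hsum : ⁅x, ∑ i, (b i).1 (g (c i))⁆ - Ω (f x) = 0 := by
    rw [← h, hΩ, lie_sum, LinearMap.sum_apply, ← Finset.sum_sub_distrib]
    refine Finset.sum_congr rfl fun i _ => ?_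
    have h1 : ⁅x, (b i).1 (g (c i))⁆ = (T x (b i)).1 (g (c i)) + (b i).1 ⁅x, g (c i)⁆ := by
      rw [hT]; simp
    rw [h1, hcomm, map_add]
    simp only [LinearMap.compl₁₂_apply, Submodule.subtype_apply, LinearMap.id_apply,
      Module.End.mul_apply]
    abel
  exact sub_eq_zero.1 hsum

end LieModules

/-! ### Cocycles across a chief factor acting nontrivially -/

section ChiefFactors

open LieModule

variable {F L S : Type*} [Field F] [LieRing L] [LieAlgebra F L]
  [AddCommGroup S] [Module F S] [LieRingModule L S] [LieModule F L S]

/-- Cartan's criterion makes `⁅J, J⁆` act by nilpotent operators, hence by zero, by Engel's theorem.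
-/
theorem toEnd_commute_of_traceForm_eq_zero [CharZero F] [FiniteDimensional F S]
    [IsIrreducible F L S] {J : LieIdeal F L}
    (h : ∀ y ∈ J, ∀ z ∈ J, LinearMap.trace F S (toEnd F L S y * toEnd F L S z) = 0)
    {y z : L} (hy : y ∈ J) (hz : z ∈ J) : Commute (toEnd F L S y) (toEnd F L S z) := by
  have htf : traceForm F J S = 0 := by
    ext y z
    exact h y.1 y.2 z.1 z.2
  have hnil := isNilpotent_derivedSeries_of_traceForm_eq_zero htf
  have htriv : ActsTrivially ⁅J, J⁆ S := .of_isNilpotent fun x hx => by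
    refine (LieModule.isNilpotent_iff_forall' (R := F)).1 hnil
      ⟨⟨x, LieSubmodule.lie_le_left J J hx⟩, ?_⟩
    rwa [LieIdeal.derivedSeries_eq_derivedSeriesOfIdeal_comap, LieIdeal.mem_comap]
  refine sub_eq_zero.1 ?_
  rw [← toEnd_lie]
  exact LinearMap.ext fun s => htriv _ (LieSubmodule.lie_mem_lie hy hz) s

/-- On a generator `⁅x, b⁆` this is cyclicity of the trace, as `c` commutes with `b`. -/
theorem trace_mul_toEnd_eq_zero {J : LieIdeal F L} (c : Module.End F S)
    (hc : ∀ y ∈ J, Commute c (toEnd F L S y)) {y : L} (hy : y ∈ ⁅(⊤ : LieIdeal F L), J⁆) :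
    LinearMap.trace F S (c * toEnd F L S y) = 0 := by
  rw [← LieSubmodule.mem_toSubmodule, LieSubmodule.lieIdeal_oper_eq_linear_span'] at hy
  induction hy using Submodule.span_induction with
  | mem y h =>
    obtain ⟨x, -, b, hb, rfl⟩ := h
    rw [toEnd_lie, mul_sub, map_sub, ← mul_assoc, LinearMap.trace_mul_comm, ← mul_assoc,
      ← (hc b hb).eq, mul_assoc, sub_self]
  | zero => simp
  | add y z _ _ hy hz => rw [map_add, mul_add, map_add, hy, hz, add_zero]
  | smul t y _ hy => rw [map_smul, mul_smul_comm, map_smul, hy, smul_zero]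

/-- A cocycle that vanishes on an ideal `I` is a coboundary if there is a chief factor `J/I` such
that `I` acts trivially and `J` acts nontrivially on the coefficients. -/
theorem mem_oneCoboundaries_of_not_actsTrivially [CharZero F] [FiniteDimensional F S]
    [IsIrreducible F L S] {I J : LieIdeal F L} (hIJ : I ≤ J)
    (hmin : ∀ R : LieIdeal F L, I ≤ R → R ≤ J → R = I ∨ R = J)
    (hI : ActsTrivially I S) (hJ : ¬ ActsTrivially J S)
    {f : L →ₗ[F] S} (hf : f ∈ oneCocycles F L S) (hfI : ∀ y ∈ I, f y = 0) :
    f ∈ oneCoboundaries F L S := by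
  have hI' : ∀ y ∈ I, toEnd F L S y = 0 := fun y hy => LinearMap.ext (hI y hy)
  -- The radical of the trace form on `J`; it contains `I`, so minimality leaves only `I` and `J`.
  let R : LieIdeal F L :=
    { carrier := {y | y ∈ J ∧ ∀ z ∈ J,
        LinearMap.trace F S (toEnd F L S y * toEnd F L S z) = 0}
      add_mem' := fun {a b} ha hb => ⟨add_mem ha.1 hb.1, fun z hz => by
        rw [map_add, add_mul, map_add, ha.2 z hz, hb.2 z hz, add_zero]⟩
      zero_mem' := ⟨zero_mem J, fun z _ => by simp⟩
      smul_mem' := fun t y hy => ⟨J.smul_mem t hy.1, fun z hz => by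
        rw [map_smul, smul_mul_assoc, map_smul, hy.2 z hz, smul_zero]⟩
      lie_mem := fun {x y} hy => ⟨J.lie_mem hy.1, fun z hz => by
        have h := hy.2 ⁅x, z⁆ (J.lie_mem hz)
        rw [toEnd_lie, mul_sub, map_sub] at h
        rw [toEnd_lie, sub_mul, map_sub, mul_assoc, LinearMap.trace_mul_comm, mul_assoc,
          mul_assoc, ← neg_sub, h, neg_zero]⟩ }
  have hRdef : ∀ y, y ∈ R ↔ y ∈ J ∧ ∀ z ∈ J,
      LinearMap.trace F S (toEnd F L S y * toEnd F L S z) = 0 := fun _ => Iff.rfl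
  rcases hmin R (fun y hy => ⟨hIJ hy, fun z _ => by simp [hI' y hy]⟩) (fun y hy => hy.1)
    with hR | hR
  · refine mem_oneCoboundaries_of_nondegenerate hJ
      (fun y hy h => hI y (hR ▸ (hRdef y).2 ⟨hy, h⟩)) hf fun y hy h => hfI y ?_
    have hyR : y ∈ R := (hRdef y).2 ⟨hy, fun z _ => by
      rw [show toEnd F L S y = 0 from LinearMap.ext h, zero_mul, map_zero]⟩
    exact hR ▸ hyR
  have hcomm : ∀ y ∈ J, ∀ z ∈ J, Commute (toEnd F L S y) (toEnd F L S z) := fun y hy z hz =>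
    toEnd_commute_of_traceForm_eq_zero (fun y hy => ((hRdef y).1 (hR ▸ hy)).2) hy hz
  rw [mem_oneCocycles_iff] at hf
  rcases hmin (I ⊔ ⁅(⊤ : LieIdeal F L), J⁆) le_sup_left
    (sup_le hIJ (LieSubmodule.lie_le_right J ⊤)) with hE | hE
  -- Here `J/I` is central, so some `y` in `J` acts as an invertible operator commuting with `L`. As
  -- `f ⁅x, y⁆ = 0`, the cocycle identity reads `⁅y, f x⁆ = ⁅x, f y⁆`, and `f` is the coboundary of
  -- `y⁻¹ (f y)`.
  · have hmemI : ∀ x, ∀ y ∈ J, ⁅x, y⁆ ∈ I := fun x y hy => hE ▸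
      (le_sup_right : _ ≤ I ⊔ ⁅(⊤ : LieIdeal F L), J⁆)
        (LieSubmodule.lie_mem_lie (LieSubmodule.mem_top x) hy)
    obtain ⟨y, hy, s, hs⟩ : ∃ y ∈ J, ∃ s : S, ⁅y, s⁆ ≠ 0 := by
      simpa [ActsTrivially] using hJ
    have hyx : ∀ (x : L) (m : S), ⁅y, ⁅x, m⁆⁆ = ⁅x, ⁅y, m⁆⁆ := fun x m => by
      rw [leibniz_lie x y m, hI _ (hmemI x y hy) m, zero_add]
    obtain ⟨hinj, hsurj⟩ := bijective_of_commute (L := L) (toEnd F L S y) hyx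
      fun h => hs (LinearMap.congr_fun h s)
    obtain ⟨t, ht⟩ := hsurj (f y)
    refine mem_oneCoboundaries_iff.2 ⟨t, fun x => hinj ?_⟩
    have h := hf x y
    rw [hfI _ (hmemI x y hy), eq_comm, sub_eq_zero] at h
    simp only [toEnd_apply_apply] at ht ⊢
    rw [hyx, ht, h]
  -- Modulo `I`, each `y` in `J` lies in `[L, J]`, and its powers commute with the action of `J`; so
  -- all positive powers have trace zero.
  · refine absurd (ActsTrivially.of_isNilpotent fun y hy =>
      Module.End.isNilpotent_of_trace_pow_eq_zero _ fun k => ?_) hJ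
    obtain ⟨u, hu, v, hv, rfl⟩ := (LieSubmodule.mem_sup _ _ _).1 (hE ▸ hy)
    have huv : toEnd F L S (u + v) = toEnd F L S v := by rw [map_add, hI' u hu, zero_add]
    rw [huv, pow_succ]
    exact trace_mul_toEnd_eq_zero _ (fun z hz =>
      (hcomm v (LieSubmodule.lie_le_right J ⊤ hv) z hz).pow_left k) hv

end ChiefFactors

/-! ### Cocycles vanishing on an ideal, and split factors -/

section Filtration

open LieModule

variable {F L S : Type*} [Field F] [LieRing L] [LieAlgebra F L]
  [AddCommGroup S] [Module F S] [LieRingModule L S] [LieModule F L S]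

theorem quotHom_eq_zero_iff {I : LieIdeal F L} {x : L} : quotHom I x = 0 ↔ x ∈ I :=
  Submodule.Quotient.mk_eq_zero I.toSubmodule

theorem quotHom_eq_iff {I : LieIdeal F L} {x y : L} : quotHom I x = quotHom I y ↔ x - y ∈ I := by
  rw [← quotHom_eq_zero_iff, map_sub, sub_eq_zero]

theorem quotHom_surjective (I : LieIdeal F L) : Function.Surjective (quotHom I) :=
  I.toSubmodule.mkQ_surjective

theorem mem_quotIdeal_iff {I J : LieIdeal F L} {z : L ⧸ I} :
    z ∈ quotIdeal I J ↔ ∃ y ∈ J, quotHom I y = z := by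
  rw [quotIdeal, ← LieSubmodule.mem_toSubmodule,
    LieIdeal.coe_map_of_surjective (quotHom_surjective I)]
  rfl

theorem quotHom_mem_quotIdeal {I J : LieIdeal F L} {y : L} (hy : y ∈ J) :
    quotHom I y ∈ quotIdeal I J := mem_quotIdeal_iff.2 ⟨y, hy, rfl⟩

theorem eq_or_eq_of_isAtom_quotIdeal {I J : LieIdeal F L} (h : IsAtom (quotIdeal I J))
    (R : LieIdeal F L) (hIR : I ≤ R) (hRJ : R ≤ J) : R = I ∨ R = J := by
  rcases h.le_iff.1 (show quotIdeal I R ≤ quotIdeal I J from LieIdeal.map_mono hRJ) with hR | hR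
  · refine .inl (le_antisymm (fun y hy => ?_) hIR)
    have := quotHom_mem_quotIdeal (I := I) hy
    rw [hR, LieSubmodule.mem_bot] at this
    exact quotHom_eq_zero_iff.1 this
  · refine .inr (le_antisymm hRJ fun y hy => ?_)
    have := quotHom_mem_quotIdeal (I := I) hy
    rw [← hR] at this
    obtain ⟨z, hz, hzy⟩ := mem_quotIdeal_iff.1 this
    have := hIR (quotHom_eq_iff.1 hzy)
    simpa using sub_mem hz this

variable (S) in
/-- The 1-cocycles of `L` that vanish on the ideal `I`. -/
def cocyclesVanishingOn (I : LieIdeal F L) : Submodule F (L →ₗ[F] S) where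
  carrier := {f | f ∈ oneCocycles F L S ∧ ∀ y ∈ I, f y = 0}
  add_mem' := fun {a b} ha hb => ⟨add_mem ha.1 hb.1, fun y hy => by
    rw [LinearMap.add_apply, ha.2 y hy, hb.2 y hy, add_zero]⟩
  zero_mem' := ⟨zero_mem _, fun _ _ => rfl⟩
  smul_mem' := fun t f hf => ⟨Submodule.smul_mem _ t hf.1, fun y hy => by
    rw [LinearMap.smul_apply, hf.2 y hy, smul_zero]⟩

theorem mem_cocyclesVanishingOn {I : LieIdeal F L} {f : L →ₗ[F] S} :
    f ∈ cocyclesVanishingOn S I ↔ f ∈ oneCocycles F L S ∧ ∀ y ∈ I, f y = 0 := Iff.rfl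

theorem cocyclesVanishingOn_anti {I J : LieIdeal F L} (h : I ≤ J) :
    cocyclesVanishingOn S J ≤ cocyclesVanishingOn S I :=
  fun _ hf => ⟨hf.1, fun y hy => hf.2 y (h hy)⟩

/-- The cocycle identity at `x` and `y ∈ I` shows that `I` kills every value `f x`; a nonzero value
would make `I` act trivially. -/
theorem cocyclesVanishingOn_eq_bot [IsIrreducible F L S] {I : LieIdeal F L}
    (hI : ¬ ActsTrivially I S) : cocyclesVanishingOn S I = ⊥ := by
  refine (Submodule.eq_bot_iff _).2 fun f hf => LinearMap.ext fun x => ?_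
  by_contra hx
  refine hI (.of_invariant hx fun y hy => ?_)
  have h := mem_oneCocycles_iff.1 hf.1 x y
  rw [hf.2 _ (I.lie_mem hy), hf.2 y hy, lie_zero, zero_sub] at h
  exact neg_eq_zero.1 h.symm

theorem oneCoboundaries_le_cocyclesVanishingOn {I : LieIdeal F L} (hI : ActsTrivially I S) :
    oneCoboundaries F L S ≤ cocyclesVanishingOn S I := fun f hf =>
  ⟨oneCoboundaries_le_oneCocycles F L S hf, fun y hy => by
    obtain ⟨s, hs⟩ := mem_oneCoboundaries_iff.1 hf
    rw [← hs]; exact hI y hy s⟩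

/-- The chief factor `J/I` is abelian, isomorphic to `S` and split. -/
def IsSplitFactor {I J : LieIdeal F L} (h : I ≤ J) (S : Type*) [AddCommGroup S] [Module F S]
    [LieRingModule L S] : Prop :=
  IsLieAbelian (quotIdeal I J) ∧ IsModuleIso I J S ∧ IsSplit h

omit [LieModule F L S] in
-- An abelian factor is killed by `J`, and the module isomorphism carries this to `S`.
theorem IsSplitFactor.actsTrivially {I J : LieIdeal F L} {h : I ≤ J}
    (hs : IsSplitFactor h S) : ActsTrivially J S := by
  obtain ⟨hab, ⟨e, he⟩, -⟩ := hs
  intro y hy s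
  obtain ⟨v, rfl⟩ := e.surjective s
  rw [← he]
  have h0 : ⁅quotHom I y, v⁆ = 0 := by
    have := hab.trivial ⟨quotHom I y, quotHom_mem_quotIdeal hy⟩ v
    exact Subtype.ext (congrArg Subtype.val this)
  rw [h0, map_zero]

theorem lie_eq_of_mem_cocyclesVanishingOn {I J : LieIdeal F L} (hJ : ActsTrivially J S)
    {f : L →ₗ[F] S} (hf : f ∈ cocyclesVanishingOn S I) (x : L) {y : L} (hy : y ∈ J) :
    f ⁅x, y⁆ = ⁅x, f y⁆ := by
  rw [mem_oneCocycles_iff.1 hf.1, hJ y hy, sub_zero]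

/-- A cocycle that vanishes on `I` but not on `J` makes `J/I` a split factor. -/
theorem isSplitFactor_of_apply_ne_zero [IsIrreducible F L S] {I J : LieIdeal F L} (hIJ : I ≤ J)
    (hmin : ∀ R : LieIdeal F L, I ≤ R → R ≤ J → R = I ∨ R = J) (hJ : ActsTrivially J S)
    {f : L →ₗ[F] S} (hf : f ∈ cocyclesVanishingOn S I) {y₀ : L} (hy₀ : y₀ ∈ J) (hfy : f y₀ ≠ 0) :
    IsSplitFactor hIJ S := by
  have hlie := fun x y (hy : y ∈ J) => lie_eq_of_mem_cocyclesVanishingOn hJ hf x hy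
  have hker : ∀ y ∈ J, f y = 0 → y ∈ I := by
    let K : LieIdeal F L :=
      { J.toSubmodule ⊓ LinearMap.ker f with
        lie_mem := fun {x y} hy => ⟨J.lie_mem hy.1, by
          have h2 : f y = 0 := hy.2
          change f ⁅x, y⁆ = 0
          rw [hlie x y hy.1, h2, lie_zero]⟩ }
    have hK : K = I := (hmin K (fun y hy => ⟨hIJ hy, hf.2 y hy⟩) fun y hy => hy.1).resolve_right
      fun h => hfy (show y₀ ∈ K from h ▸ hy₀).2
    exact fun y hy h0 => hK ▸ (show y ∈ K from ⟨hy, h0⟩)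
  let g : J.toSubmodule →ₗ[F] S := f ∘ₗ J.toSubmodule.subtype
  have hg : Function.Surjective g := by
    let N : LieSubmodule F L S :=
      { LinearMap.range g with
        lie_mem := by
          rintro x _ ⟨y, rfl⟩
          exact ⟨⟨⁅x, y.1⁆, J.lie_mem y.2⟩, hlie x y.1 y.2⟩ }
    have hN : N = ⊤ := (IsSimpleOrder.eq_bot_or_eq_top N).resolve_left fun hb =>
      hfy ((LieSubmodule.mem_bot _).1 (hb ▸ (show f y₀ ∈ N from ⟨⟨y₀, hy₀⟩, rfl⟩)))
    exact fun s => (show s ∈ N from hN ▸ LieSubmodule.mem_top s)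
  refine ⟨⟨fun u v => ?_⟩, ?_, ?_⟩
  · obtain ⟨u, hu⟩ := u
    obtain ⟨v, hv⟩ := v
    obtain ⟨y, hy, rfl⟩ := mem_quotIdeal_iff.1 hu
    obtain ⟨z, hz, rfl⟩ := mem_quotIdeal_iff.1 hv
    refine Subtype.ext ?_
    change ⁅quotHom I y, quotHom I z⁆ = 0
    rw [← LieHom.map_lie, quotHom_eq_zero_iff]
    exact hker _ (J.lie_mem hz) (by rw [hlie y z hz, hJ y hy])
  · let p : J.toSubmodule →ₗ[F] quotIdeal I J :=
      ((quotHom I : L →ₗ[F] L ⧸ I) ∘ₗ J.toSubmodule.subtype).codRestrict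
        (quotIdeal I J).toSubmodule fun y => quotHom_mem_quotIdeal y.2
    have hp : ∀ y, (p y).1 = quotHom I y.1 := fun _ => rfl
    have hps : Function.Surjective p := by
      rintro ⟨v, hv⟩
      obtain ⟨y, hy, rfl⟩ := mem_quotIdeal_iff.1 hv
      exact ⟨⟨y, hy⟩, rfl⟩
    have hp0 : ∀ y, p y = 0 ↔ y.1 ∈ I := fun y => by
      rw [← quotHom_eq_zero_iff, ← hp]
      exact ⟨fun h => congrArg Subtype.val h, fun h => Subtype.ext h⟩
    obtain ⟨e, he⟩ := LinearMap.exists_comp_eq_of_ker_le p g hps fun y hy =>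
      hf.2 _ ((hp0 y).1 hy)
    have hbij : Function.Bijective e := by
      constructor
      · refine (injective_iff_map_eq_zero e).2 fun v hv => ?_
        obtain ⟨y, rfl⟩ := hps v
        rw [he] at hv
        exact (hp0 y).2 (hker y.1 y.2 hv)
      · intro s
        obtain ⟨y, rfl⟩ := hg s
        exact ⟨p y, he y⟩
    refine ⟨LinearEquiv.ofBijective e hbij, fun x v => ?_⟩
    obtain ⟨y, rfl⟩ := hps v
    have hxy : ⁅quotHom I x, p y⁆ = p ⟨⁅x, y.1⁆, J.lie_mem y.2⟩ := Subtype.ext rfl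
    rw [LinearEquiv.ofBijective_apply, LinearEquiv.ofBijective_apply, hxy, he, he]
    exact hlie x y.1 y.2
  · obtain ⟨r, hr⟩ := g.exists_rightInverse_of_surjective (LinearMap.range_eq_top.2 hg)
    have hr' : ∀ s, f (r s).1 = s := fun s => LinearMap.congr_fun hr s
    -- The projection onto `ker f` along a linear complement of `I` in `J`. A cocycle's zeros form a
    -- subalgebra, here meeting `J` in `I`, so `k` descends to a Lie section `L/J → L/I`.
    let k : L →ₗ[F] L := LinearMap.id - J.toSubmodule.subtype ∘ₗ r ∘ₗ f
    have hk : ∀ x, k x = x - (r (f x)).1 := fun _ => rfl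
    have hfk : ∀ x, f (k x) = 0 := fun x => by rw [hk, map_sub, hr', sub_self]
    have hkJ : ∀ x, k x - x ∈ J := fun x => by
      rw [hk, sub_sub_cancel_left]; exact neg_mem (r (f x)).2
    let t : (L ⧸ J) →ₗ[F] (L ⧸ I) :=
      J.toSubmodule.liftQ ((quotHom I : L →ₗ[F] L ⧸ I) ∘ₗ k) fun x hx =>
        quotHom_eq_zero_iff.2 (hker _ (by simpa using add_mem (hkJ x) hx) (hfk x))
    have ht : ∀ x, t (quotHom J x) = quotHom I (k x) := fun _ => rfl
    refine ⟨{ t with map_lie' := ?_ }, ?_⟩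
    · intro u v
      obtain ⟨x, rfl⟩ := quotHom_surjective J u
      obtain ⟨y, rfl⟩ := quotHom_surjective J v
      change t ⁅quotHom J x, quotHom J y⁆ = ⁅t (quotHom J x), t (quotHom J y)⁆
      rw [← LieHom.map_lie, ht, ht, ht, ← LieHom.map_lie, quotHom_eq_iff]
      refine hker _ ?_ ?_
      · have h1 := hkJ ⁅x, y⁆
        have h2 : ⁅k x, k y⁆ - ⁅x, y⁆ ∈ J := by
          have : ⁅k x, k y⁆ - ⁅x, y⁆ = ⁅k x - x, k y⁆ + ⁅x, k y - y⁆ := by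
            rw [sub_lie, lie_sub]; abel
          rw [this]
          exact add_mem (lie_mem_left F L J _ _ (hkJ x)) (J.lie_mem (hkJ y))
        simpa using sub_mem h1 h2
      · rw [map_sub, hfk, mem_oneCocycles_iff.1 hf.1, hfk, hfk, lie_zero, lie_zero, sub_zero,
          sub_zero]
    · ext u
      obtain ⟨x, rfl⟩ := quotHom_surjective J u
      change quotHom J (k x) = quotHom J x
      exact quotHom_eq_iff.2 (hkJ x)

/-- A split factor isomorphic to `S` carries a cocycle that restricts to an isomorphism. -/
theorem IsSplitFactor.exists_cocycle {I J : LieIdeal F L} {h : I ≤ J}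
    (hs : IsSplitFactor h S) : ∃ g ∈ cocyclesVanishingOn S I,
      (∀ s, ∃ y ∈ J, g y = s) ∧ ∀ y ∈ J, g y = 0 → y ∈ I := by
  have hJ := hs.actsTrivially
  obtain ⟨hab, ⟨e, he⟩, t, ht⟩ := hs
  have hfac : ∀ x, quotFactor h (quotHom I x) = quotHom J x := fun _ => rfl
  have ht' : ∀ u, quotFactor h (t u) = u := fun u => LieHom.congr_fun ht u
  -- The component in `J/I` along the image of the section; it is a cocycle because `J/I` is
  -- abelian.
  let k : L →ₗ[F] L ⧸ I :=
    (quotHom I : L →ₗ[F] L ⧸ I) - (t : (L ⧸ J) →ₗ[F] (L ⧸ I)) ∘ₗ (quotHom J : L →ₗ[F] L ⧸ J)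
  have hk : ∀ x, k x = quotHom I x - t (quotHom J x) := fun _ => rfl
  have hkmem : ∀ x, k x ∈ quotIdeal I J := fun x => by
    obtain ⟨z, hz⟩ := quotHom_surjective I (t (quotHom J x))
    have h1 : quotHom J z = quotHom J x := by rw [← hfac, hz, ht']
    rw [hk, ← hz, ← map_sub]
    refine quotHom_mem_quotIdeal ?_
    rw [← neg_sub]
    exact neg_mem (quotHom_eq_iff.1 h1)
  have hkJ : ∀ y ∈ J, k y = quotHom I y := fun y hy => by
    rw [hk, quotHom_eq_zero_iff.2 hy, map_zero, sub_zero]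
  let k' : L →ₗ[F] quotIdeal I J := k.codRestrict (quotIdeal I J).toSubmodule hkmem
  have hk' : ∀ x, (k' x).1 = k x := fun _ => rfl
  refine ⟨e.toLinearMap ∘ₗ k', ⟨mem_oneCocycles_iff.2 fun x y => ?_, fun y hy => ?_⟩,
    fun s => ?_, fun y hy h0 => ?_⟩
  · simp only [LinearMap.comp_apply, LinearEquiv.coe_coe]
    rw [← he, ← he, ← map_sub]
    congr 1
    refine Subtype.ext ?_
    have h0 : ⁅k x, k y⁆ = 0 :=
      congrArg Subtype.val (hab.trivial (k' x) (k' y))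
    change k ⁅x, y⁆ = ⁅quotHom I x, k y⁆ - ⁅quotHom I y, k x⁆
    rw [← lie_skew (quotHom I y), sub_neg_eq_add]
    have hx : quotHom I x = k x + t (quotHom J x) := by rw [hk]; abel
    have hy : quotHom I y = k y + t (quotHom J y) := by rw [hk]; abel
    rw [hk ⁅x, y⁆, LieHom.map_lie, LieHom.map_lie, LieHom.map_lie, hx, hy]
    simp only [add_lie, lie_add, h0]
    abel
  · simp only [LinearMap.comp_apply, LinearEquiv.coe_coe]
    rw [e.map_eq_zero_iff]
    exact Subtype.ext ((hkJ y (h hy)).trans (quotHom_eq_zero_iff.2 hy))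
  · obtain ⟨y, hy, hys⟩ := mem_quotIdeal_iff.1 (e.symm s).2
    refine ⟨y, hy, ?_⟩
    simp only [LinearMap.comp_apply, LinearEquiv.coe_coe]
    rw [← LinearEquiv.eq_symm_apply]
    exact Subtype.ext ((hkJ y hy).trans hys)
  · simp only [LinearMap.comp_apply, LinearEquiv.coe_coe] at h0
    rw [e.map_eq_zero_iff] at h0
    rw [← quotHom_eq_zero_iff, ← hkJ y hy, ← hk', h0]
    rfl

end Filtration

/-! ### Dimension count for one chief factor -/

section Dimension

open LieModule

variable {F L S : Type*} [Field F] [LieRing L] [LieAlgebra F L] [FiniteDimensional F L]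
  [AddCommGroup S] [Module F S] [LieRingModule L S] [LieModule F L S] [FiniteDimensional F S]

variable (S) in
/-- The cocycles that are cohomologous to one vanishing on the ideal `I`. -/
def cocyclesSplittingOn (I : LieIdeal F L) : Submodule F (L →ₗ[F] S) :=
  cocyclesVanishingOn S I ⊔ oneCoboundaries F L S

variable (S) in
/-- Restriction to `J` of the cocycles vanishing on `I`. -/
def restrictCocycles (I J : LieIdeal F L) : cocyclesVanishingOn S I →ₗ[F] J.toSubmodule →ₗ[F] S :=
  LinearMap.lcomp F S J.toSubmodule.subtype ∘ₗ (cocyclesVanishingOn S I).subtype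

theorem finrank_cocyclesVanishingOn {I J : LieIdeal F L} (hIJ : I ≤ J) :
    Module.finrank F (cocyclesVanishingOn S I) = Module.finrank F (cocyclesVanishingOn S J) +
      Module.finrank F (LinearMap.range (restrictCocycles S I J)) := by
  rw [← (restrictCocycles S I J).finrank_range_add_finrank_ker, add_comm]
  congr 1
  have hker : LinearMap.ker (restrictCocycles S I J) =
      (cocyclesVanishingOn S J).submoduleOf (cocyclesVanishingOn S I) := by
    ext f
    rw [LinearMap.mem_ker, Submodule.submoduleOf, Submodule.mem_comap]
    exact ⟨fun h => ⟨f.2.1, fun y hy => LinearMap.congr_fun h ⟨y, hy⟩⟩,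
      fun h => LinearMap.ext fun y => h.2 y.1 y.2⟩
  rw [hker]
  exact (Submodule.submoduleOfEquivOfLe (cocyclesVanishingOn_anti hIJ)).finrank_eq

omit [FiniteDimensional F L] [FiniteDimensional F S] in
theorem IsSplitFactor.finrank_range_restrictCocycles {I J : LieIdeal F L} {h : I ≤ J}
    (hs : IsSplitFactor h S) :
    Module.finrank F (LinearMap.range (restrictCocycles S I J)) =
      Module.finrank F (S →ₗ⁅F,L⁆ S) := by
  have hJ := hs.actsTrivially
  obtain ⟨g, hg, hsurj, hker⟩ := hs.exists_cocycle
  let g' : J.toSubmodule →ₗ[F] S := g ∘ₗ J.toSubmodule.subtype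
  have hg's : Function.Surjective g' := fun s => by
    obtain ⟨y, hy, hys⟩ := hsurj s
    exact ⟨⟨y, hy⟩, hys⟩
  -- Since `g` identifies `J/I` with `S`, restrictions of cocycles in `Z_I` are exactly the `φ ∘ g`
  -- with `φ` in `End_L(S)`.
  let ψ : (S →ₗ⁅F,L⁆ S) →ₗ[F] J.toSubmodule →ₗ[F] S :=
    { toFun := fun φ => (φ : S →ₗ[F] S) ∘ₗ g'
      map_add' := fun _ _ => rfl
      map_smul' := fun _ _ => rfl }
  have hinj : Function.Injective ψ := fun φ₁ φ₂ h => LieModuleHom.ext fun s => by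
    obtain ⟨y, rfl⟩ := hg's s
    exact LinearMap.congr_fun h y
  suffices hrange : LinearMap.range (restrictCocycles S I J) = LinearMap.range ψ by
    rw [hrange, LinearMap.finrank_range_of_inj hinj]
  ext u
  constructor
  · rintro ⟨f, rfl⟩
    obtain ⟨φ, hφ⟩ := LinearMap.exists_comp_eq_of_ker_le g' (restrictCocycles S I J f) hg's
      fun y hy => f.2.2 _ (hker y.1 y.2 hy)
    refine ⟨{ φ with map_lie' := ?_ }, LinearMap.ext fun y => hφ y⟩
    intro x s
    obtain ⟨y, rfl⟩ := hg's s
    change φ ⁅x, g' y⁆ = ⁅x, φ (g' y)⁆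
    have h1 : ⁅x, g' y⁆ = g' ⟨⁅x, y.1⁆, J.lie_mem y.2⟩ :=
      (lie_eq_of_mem_cocyclesVanishingOn hJ hg x y.2).symm
    rw [h1, hφ, hφ]
    exact lie_eq_of_mem_cocyclesVanishingOn hJ f.2 x y.2
  · rintro ⟨φ, rfl⟩
    refine ⟨⟨(φ : S →ₗ[F] S) ∘ₗ g, mem_oneCocycles_iff.2 fun x y => ?_, fun y hy => ?_⟩, rfl⟩
    · simp [mem_oneCocycles_iff.1 hg.1]
    · simp [hg.2 y hy]

open Classical in
theorem finrank_cocyclesSplittingOn [CharZero F] [IsIrreducible F L S] {I J : LieIdeal F L}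
    (hIJ : I ≤ J) (hat : IsAtom (quotIdeal I J)) :
    Module.finrank F (cocyclesSplittingOn S I) = Module.finrank F (cocyclesSplittingOn S J) +
      if IsSplitFactor hIJ S then Module.finrank F (S →ₗ⁅F,L⁆ S) else 0 := by
  have hmin := eq_or_eq_of_isAtom_quotIdeal hat
  by_cases hJ : ActsTrivially J S
  · have hI : ActsTrivially I S := fun y hy => hJ y (hIJ hy)
    rw [cocyclesSplittingOn, cocyclesSplittingOn,
      sup_eq_left.2 (oneCoboundaries_le_cocyclesVanishingOn hI),
      sup_eq_left.2 (oneCoboundaries_le_cocyclesVanishingOn hJ), finrank_cocyclesVanishingOn hIJ]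
    congr 1
    split_ifs with hs
    · exact hs.finrank_range_restrictCocycles
    · have h0 : restrictCocycles S I J = 0 := by
        refine LinearMap.ext fun f => LinearMap.ext fun y => ?_
        by_contra hy
        exact hs (isSplitFactor_of_apply_ne_zero hIJ hmin hJ f.2 y.2 hy)
      rw [h0, LinearMap.range_zero, finrank_bot]
  · rw [if_neg fun hs => hJ hs.actsTrivially, add_zero]
    -- With this inclusion both `E_I` and `E_J` collapse to `B¹`.
    have hle : cocyclesVanishingOn S I ≤ oneCoboundaries F L S := by
      by_cases hI : ActsTrivially I S
      · exact fun f hf => mem_oneCoboundaries_of_not_actsTrivially hIJ hmin hI hJ hf.1 hf.2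
      · rw [cocyclesVanishingOn_eq_bot hI]
        exact bot_le
    rw [cocyclesSplittingOn, cocyclesSplittingOn, sup_eq_right.2 hle,
      sup_eq_right.2 ((cocyclesVanishingOn_anti hIJ).trans hle)]

omit [FiniteDimensional F L] [FiniteDimensional F S] in
theorem cocyclesSplittingOn_bot :
    cocyclesSplittingOn S (⊥ : LieIdeal F L) = oneCocycles F L S := by
  refine le_antisymm (sup_le (fun f hf => hf.1) (oneCoboundaries_le_oneCocycles F L S))
    fun f hf => Submodule.mem_sup_left ⟨hf, fun y hy => ?_⟩
  rw [(LieSubmodule.mem_bot y).1 hy, map_zero]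

omit [FiniteDimensional F L] [FiniteDimensional F S] in
theorem cocyclesSplittingOn_top :
    cocyclesSplittingOn S (⊤ : LieIdeal F L) = oneCoboundaries F L S := by
  refine sup_eq_right.2 fun f hf => ?_
  rw [show f = 0 from LinearMap.ext fun x => hf.2 x (LieSubmodule.mem_top x)]
  exact zero_mem _

theorem finrank_H1_add_finrank_oneCoboundaries :
    Module.finrank F (H1 F L S) + Module.finrank F (oneCoboundaries F L S) =
      Module.finrank F (oneCocycles F L S) := by
  rw [← (Submodule.submoduleOfEquivOfLe (oneCoboundaries_le_oneCocycles F L S)).finrank_eq]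
  exact Submodule.finrank_quotient_add_finrank _

end Dimension

end LieChief
end

theorem Fin.eq_last_add_sum_of_eq_succ_add {n : ℕ} (a : Fin (n + 1) → ℕ) (b : Fin n → ℕ)
    (h : ∀ j : Fin n, a j.castSucc = a j.succ + b j) : a 0 = a (Fin.last n) + ∑ j, b j := by
  induction n with
  | zero => simp
  | succ n ih =>
    have h₀ : a 0 = _ := ih (fun j => a j.castSucc) (fun j => b j.castSucc) fun j => h j.castSucc
    have h₁ : a (Fin.last n).castSucc = a (Fin.last (n + 1)) + b (Fin.last n) := h (Fin.last n)
    rw [Fin.sum_univ_castSucc, h₀, h₁]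
    omega

theorem theorem3p3 {F L S : Type*} [Field F] [CharZero F]
    [LieRing L] [LieAlgebra F L] [FiniteDimensional F L]
    [AddCommGroup S] [Module F S] [LieRingModule L S] [LieModule F L S]
    [FiniteDimensional F S] [LieModule.IsIrreducible F L S]
    (C : LieChief.ChiefSeries F L) :
    Module.finrank F (LieChief.H1 F L S) =
      Module.finrank F (S →ₗ⁅F,L⁆ S) * C.splitMultiplicity S := by
  classical
  -- Telescoping gives `dim Z¹ = dim B¹ + ∑ drops`; cancelling `dim B¹` leaves `dim H¹`, and each
  -- split factor contributes `dim End_L(S)`.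
  have h := Fin.eq_last_add_sum_of_eq_succ_add
    (fun j => Module.finrank F (LieChief.cocyclesSplittingOn S (C.ideal j)))
    _ fun j => LieChief.finrank_cocyclesSplittingOn (S := S) (C.le_succ j) (C.minimal j)
  rw [C.ideal_zero, C.ideal_last, LieChief.cocyclesSplittingOn_bot,
    LieChief.cocyclesSplittingOn_top, ← LieChief.finrank_H1_add_finrank_oneCoboundaries,
    add_comm] at h
  rw [Nat.add_left_cancel h, ← Finset.sum_filter, Finset.sum_const, smul_eq_mul, mul_comm,
    LieChief.ChiefSeries.splitMultiplicity, ← Set.ncard_coe_finset, Finset.coe_filter_univ]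
  rfl
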